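/- Let $\mathbb{F}$ be an algebraically closed field. A \emph{minimal basis} of a subspace $\mathcal V\subseteq\mathbb F(\lambda)^k$ is a basis of $\mathcal V$ consisting of polynomial vectors whose sum of degrees (the degree of a vector being the largest degree of its entries) is minimal among all bases of $\mathcal V$ consisting of polynomial vectors; the increasingly ordered degrees of its vectors are the \emph{minimal indices} of $\mathcal V$. The right minimal bases and right minimal indices of a rational matrix $T(\lambda)$ are those of $\{x\in\mathbb F(\lambda)^{k}:T x=0\}$, where $k$ is the number of columns of $T$. A polynomial matrix is called a minimal basis if its rows form a minimal basis of the subspace they span. Minimal bases $K(\lambda)\in\mathbb F[\lambda]^{q\times k}$ and $N(\lambda)\in\mathbb F[\lambda]^{r\times k}$ are \emph{dual} if $q+r=k$ and $K N^T=0$. A linear polynomial matrix (degree at most $1$) $\left[\begin{smallmatrix}M(\lambda)\\K(\lambda)\end{smallmatrix}\right]$ is a \emph{strong block minimal basis pencil} associated with a polynomial matrix $P(\lambda)$, with dual minimal basis $N(\lambda)$ of degree $\rho$, if $K$ and $N$ are dual minimal bases, all rows of $K$ have degree $1$, all rows of $N$ have degree $\rho$, and $M N^T=P$. Let $R(\lambda)=D(\lambda)+C(\lambda)A(\lambda)^{-1}B(\lambda)\in\mathbb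 F(\lambda)^{p\times m}$ with polynomial matrices $A\in\mathbb F[\lambda]^{n\times n}$ nonsingular ($\det A\not\equiv 0$), $B\in\mathbb F[\lambda]^{n\times m}$, $C\in\mathbb F[\lambda]^{p\times n}$, $D\in\mathbb F[\lambda]^{p\times m}$. Let $L_A=\left[\begin{smallmatrix}M_A\\K_A\end{smallmatrix}\right]$ and $L_D=\left[\begin{smallmatrix}M_D\\K_D\end{smallmatrix}\right]$ be strong block minimal basis pencils associated with $A$ and $D$, with dual minimal bases $N_A\in\mathbb F[\lambda]^{n\times(\rho_A+1)n}$ and $N_D\in\mathbb F[\lambda]^{m\times(\rho_D+1)m}$ of degrees $\rho_A$ and $\rho_D$, respectively. Let $M_B$, $M_C$ be linear polynomial matrices with $M_C N_A^T=C$ and $M_B N_D^T=B$, put $$\mathcal L(\lambda)=\left[\begin{array}{c|c} M_A(\lambda)&M_B(\lambda)\\K_A(\lambda)&0\\\hline -M_C(\lambda)&M_D(\lambda)\\0&K_D(\lambda)\end{array}\right]\in\mathbb F[\lambda]^{(n+p+\rho_An+\rho_Dm)\times(n+m+\rho_An+\rho_Dm)},$$ and let $$\widehat R(\lambda)=\begin{bmatrix}M_D\\K_D\end{bmatrix}+\begin{bmatrix}M_C\\0\end{bmatrix}\begin{bmatrix}M_A\\K_A\end{bmatrix}^{-1}\begin{bmatrix}M_B\\0\end{bmatrix}$$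 be its transfer function matrix. Write $\mathrm{rev}_dP(\lambda)=\lambda^dP(1/\lambda)$ for a polynomial matrix $P$ of degree at most $d$. Assume $$\mathrm{rank}\begin{bmatrix}A(\lambda_0)\\C(\lambda_0)\end{bmatrix}=n\ \text{ for all }\lambda_0\in\mathbb F,\qquad \mathrm{rank}\begin{bmatrix}\mathrm{rev}_{\rho_A+1}A(0)\\\mathrm{rev}_{\rho_A+1}C(0)\end{bmatrix}=n .$$ Then: (a) If $\left\{\left[\begin{smallmatrix}y_i(\lambda)\\x_i(\lambda)\end{smallmatrix}\right]\right\}_{i=1}^s$ is a right minimal basis of $\mathcal L(\lambda)$, where $x_i(\lambda)\in\mathbb F[\lambda]^{(\rho_D+1)m}$, then $\{x_i(\lambda)\}_{i=1}^s$ is a right minimal basis of $\widehat R(\lambda)$, and there is a right minimal basis $\{u_i(\lambda)\}_{i=1}^s$ of $R(\lambda)$ such that $x_i(\lambda)=N_D(\lambda)^Tu_i(\lambda)$ for $i=1,\dots,s$. (b) If $\epsilon_1\le\cdots\le\epsilon_s$ are the right minimal indices of $\mathcal L(\lambda)$, then $\epsilon_1\le\cdots\le\epsilon_s$ are the right minimal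 indices of $\widehat R(\lambda)$, and $\epsilon_1-\rho_D\le\cdots\le\epsilon_s-\rho_D$ (all nonnegative) are the right minimal indices of $R(\lambda)$. -/

import Mathlib

open Polynomial

namespace RationalLinearization

noncomputable section

/-- The degree of a polynomial vector: the largest degree of its entries
(the zero vector gets degree `0`; it never occurs in a basis). -/
def vecDegree {F : Type*} [Field F] {ν : Type*} [Fintype ν] (v : ν → F[X]) : ℕ :=
  Finset.univ.sup fun j => (v j).natDegree

/-- A polynomial vector, regarded as a vector of rational functions. -/
def vecToRat {F : Type*} [Field F] {ν : Type*} (v : ν → F[X]) : ν → RatFunc F :=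
  fun j => algebraMap F[X] (RatFunc F) (v j)

/-- A polynomial matrix, regarded as a rational matrix. -/
def matToRat {F : Type*} [Field F] {μ ν : Type*} (P : Matrix μ ν F[X]) :
    Matrix μ ν (RatFunc F) :=
  P.map (algebraMap F[X] (RatFunc F))

/-- `b` is a polynomial basis of the rational subspace `V`. -/
def IsPolynomialBasis {F : Type*} [Field F] {ι ν : Type*}
    (V : Submodule (RatFunc F) (ν → RatFunc F)) (b : ι → ν → F[X]) : Prop :=
  LinearIndependent (RatFunc F) (fun i => vecToRat (b i)) ∧
    Submodule.span (RatFunc F) (Set.range fun i => vecToRat (b i)) = V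

/-- `b` is a minimal basis of the rational subspace `V`: a polynomial basis whose sum of degrees
is minimal among all polynomial bases of `V` (all bases of `V` have the same cardinality, so they
may be indexed by the same type). -/
def IsMinimalBasis {F : Type*} [Field F] {ι ν : Type*} [Fintype ι] [Fintype ν]
    (V : Submodule (RatFunc F) (ν → RatFunc F)) (b : ι → ν → F[X]) : Prop :=
  IsPolynomialBasis V b ∧
    ∀ b' : ι → ν → F[X], IsPolynomialBasis V b' →
      ∑ i, vecDegree (b i) ≤ ∑ i, vecDegree (b' i)

/-- `ε₁ ≤ ⋯ ≤ εₛ` are the minimal indices of the rational subspace `V`: the ordered list of the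
degrees of the vectors of a minimal basis of `V`. -/
def AreMinimalIndices {F : Type*} [Field F] {ν : Type*} [Fintype ν]
    (V : Submodule (RatFunc F) (ν → RatFunc F)) {s : ℕ} (ε : Fin s → ℕ) : Prop :=
  Monotone ε ∧
    ∃ b : Fin s → ν → F[X], IsMinimalBasis V b ∧ ∀ i, vecDegree (b i) = ε i

/-- The right null-space `{x : R x = 0}` of a rational matrix. -/
def rightNullSpace {F : Type*} [Field F] {μ ν : Type*} [Fintype ν]
    (R : Matrix μ ν (RatFunc F)) : Submodule (RatFunc F) (ν → RatFunc F) :=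
  LinearMap.ker R.mulVecLin

/-- Right minimal bases of a rational matrix. -/
def IsRightMinimalBasis {F : Type*} [Field F] {ι μ ν : Type*} [Fintype ι] [Fintype ν]
    (R : Matrix μ ν (RatFunc F)) (b : ι → ν → F[X]) : Prop :=
  IsMinimalBasis (rightNullSpace R) b

/-- Right minimal indices of a rational matrix. -/
def AreRightMinimalIndices {F : Type*} [Field F] {μ ν : Type*} [Fintype ν]
    (R : Matrix μ ν (RatFunc F)) {s : ℕ} (ε : Fin s → ℕ) : Prop :=
  AreMinimalIndices (rightNullSpace R) ε

/-- A polynomial matrix is a minimal basis (by rows) if its rows form a minimal basis of the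
rational subspace that they span. -/
def IsRowMinimalBasis {F : Type*} [Field F] {κ ν : Type*} [Fintype κ] [Fintype ν]
    (K : Matrix κ ν F[X]) : Prop :=
  IsMinimalBasis (Submodule.span (RatFunc F) (Set.range fun i => vecToRat (K i)))
    (fun i => K i)

/-- `K` and `N` are dual minimal bases. -/
structure AreDualMinimalBases {F : Type*} [Field F] {κ μ ν : Type*}
    [Fintype κ] [Fintype μ] [Fintype ν]
    (K : Matrix κ ν F[X]) (N : Matrix μ ν F[X]) : Prop where
  left_minimal : IsRowMinimalBasis K
  right_minimal : IsRowMinimalBasis N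
  card_add : Fintype.card κ + Fintype.card μ = Fintype.card ν
  mul_transpose : K * N.transpose = 0

/-- A linear polynomial matrix `λ M₁ + M₀`. -/
def IsLinearMatrix {F : Type*} [Field F] {μ ν : Type*} (M : Matrix μ ν F[X]) : Prop :=
  ∀ i j, (M i j).natDegree ≤ 1

/-- `[M; K]` is a (degenerate, that is, one block column) strong block minimal basis pencil
associated with the polynomial matrix `P`, where `N` is a minimal basis dual to `K`, and `ρ` is the
common degree of the rows of `N`, so that `ρ = deg N`. -/
structure IsStrongBlockMinimalBasisPencil {F : Type*} [Field F] {ι κ μ ν : Type*}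
    [Fintype κ] [Fintype μ] [Fintype ν]
    (M : Matrix ι ν F[X]) (K : Matrix κ ν F[X]) (N : Matrix μ ν F[X]) (ρ : ℕ)
    (P : Matrix ι μ F[X]) : Prop where
  linear_top : IsLinearMatrix M
  linear_bottom : IsLinearMatrix K
  dual : AreDualMinimalBases K N
  rowDegree_bottom : ∀ i, vecDegree (K i) = 1
  rowDegree_dual : ∀ i, vecDegree (N i) = ρ
  associated : M * N.transpose = P

/-- The transfer function matrix of a polynomial system matrix `[A, B; -C, D]`: the Schur
complement `D + C A⁻¹ B` of the state matrix `A`. -/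
def transferFunction {F : Type*} [Field F] {α β γ : Type*} [Fintype α] [DecidableEq α]
    (P : Matrix (α ⊕ β) (α ⊕ γ) F[X]) : Matrix β γ (RatFunc F) :=
  matToRat P.toBlocks₂₂ -
    matToRat P.toBlocks₂₁ * (matToRat P.toBlocks₁₁)⁻¹ * matToRat P.toBlocks₁₂

/-- The linear polynomial system matrix
`[M_A, M_B; K_A, 0; -M_C, M_D; 0, K_D]` with state matrix `[M_A; K_A]`. -/
def linearization {F : Type*} [Field F] {α κ β δ ν ω : Type*}
    (MA : Matrix α ν F[X]) (KA : Matrix κ ν F[X]) (MB : Matrix α ω F[X])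
    (MC : Matrix β ν F[X]) (MD : Matrix β ω F[X]) (KD : Matrix δ ω F[X]) :
    Matrix ((α ⊕ κ) ⊕ (β ⊕ δ)) (ν ⊕ ω) F[X] :=
  Matrix.fromBlocks
    (Matrix.fromRows MA KA) (Matrix.fromRows MB 0)
    (Matrix.fromRows (-MC) 0) (Matrix.fromRows MD KD)

/-- The reversal `rev_d P (λ) = λ ^ d P (1 / λ)` of a polynomial matrix of degree at most `d`. -/
def matRev {F : Type*} [Field F] {μ ν : Type*} (d : ℕ) (P : Matrix μ ν F[X]) :
    Matrix μ ν F[X] :=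
  P.map (Polynomial.reflect d)

/-- The value `P (a)` of a polynomial matrix. -/
def matEval {F : Type*} [Field F] {μ ν : Type*} (a : F) (P : Matrix μ ν F[X]) :
    Matrix μ ν F :=
  P.map (Polynomial.eval a)

end

end RationalLinearization

open RationalLinearization

/-!
Block elimination shows that `(y, x) ↦ x` maps the right null-space of `L` bijectively onto that of
`Rhat`, and duality of `K_D` and `N_D` shows that `u ↦ N_Dᵀ u` maps the right null-space of `R`
bijectively onto that of `Rhat`. Minimal bases correspond under both maps because these reflect
polynomial vectors and raise their degrees by `0` and `ρ_D`, respectively.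

Indeed, a polynomial matrix of degree `d` with full column rank at all finite points and at infinity
reflects polynomial vectors and raises degrees by exactly `d`. This applies to `N_Dᵀ`, since `N_D`
is a minimal basis with constant row degrees. It also applies to `[A; C]`: for `y = N_Aᵀ w`, the
null vectors `(y, x)` of `L` satisfy `[A; C] w = [-M_B; M_D] x`, so `w` is polynomial whenever `x`
is, with `deg w + ρ_A + 1 ≤ deg x + 1`, and therefore `deg y ≤ deg w + ρ_A ≤ deg x`.
-/

namespace RationalLinearization

open Function Matrix

section PolynomialVectors

variable {F : Type*} [Field F] {μ ν κ : Type*}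

theorem vecToRat_injective : Injective (vecToRat : (ν → F[X]) → ν → RatFunc F) :=
  fun _ _ h => funext fun j => RatFunc.algebraMap_injective F (congrFun h j)

theorem vecToRat_zero : vecToRat (0 : ν → F[X]) = 0 :=
  funext fun _ => map_zero _

theorem vecToRat_eq_zero {v : ν → F[X]} : vecToRat v = 0 ↔ v = 0 := by
  rw [← vecToRat_zero, vecToRat_injective.eq_iff]

theorem vecToRat_smul (q : F[X]) (v : ν → F[X]) :
    vecToRat (q • v) = algebraMap F[X] (RatFunc F) q • vecToRat v :=
  funext fun _ => map_mul _ _ _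

theorem vecToRat_sum_smul {ι : Type*} [Fintype ι] (c : ι → F[X]) (b : ι → ν → F[X]) :
    vecToRat (∑ i, c i • b i) = ∑ i, algebraMap F[X] (RatFunc F) (c i) • vecToRat (b i) := by
  ext j
  simp [vecToRat, Algebra.smul_def]

theorem vecToRat_sumElim (y : μ → F[X]) (x : ν → F[X]) :
    vecToRat (Sum.elim y x) = Sum.elim (vecToRat y) (vecToRat x) := by
  ext (j | j) <;> rfl

theorem vecToRat_mulVec [Fintype ν] (P : Matrix μ ν F[X]) (v : ν → F[X]) :
    vecToRat (P *ᵥ v) = matToRat P *ᵥ vecToRat v :=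
  funext fun i => (algebraMap F[X] (RatFunc F)).map_mulVec P v i

theorem matToRat_mul [Fintype ν] (P : Matrix μ ν F[X]) (Q : Matrix ν κ F[X]) :
    matToRat (P * Q) = matToRat P * matToRat Q :=
  Matrix.map_mul

theorem matToRat_neg (P : Matrix μ ν F[X]) : matToRat (-P) = -matToRat P := by
  ext
  simp [matToRat]

theorem matToRat_zero : matToRat (0 : Matrix μ ν F[X]) = 0 :=
  Matrix.map_zero _ (map_zero _)

theorem matToRat_fromRows (P : Matrix μ ν F[X]) (Q : Matrix κ ν F[X]) :
    matToRat (fromRows P Q) = fromRows (matToRat P) (matToRat Q) :=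
  fromRows_map _ _ _

theorem matToRat_fromBlocks {μ' ν' : Type*} (A : Matrix μ ν F[X]) (B : Matrix μ ν' F[X])
    (C : Matrix μ' ν F[X]) (D : Matrix μ' ν' F[X]) :
    matToRat (fromBlocks A B C D) =
      fromBlocks (matToRat A) (matToRat B) (matToRat C) (matToRat D) :=
  fromBlocks_map _ _ _ _ _

theorem det_matToRat [Fintype ν] [DecidableEq ν] (P : Matrix ν ν F[X]) :
    (matToRat P).det = algebraMap F[X] (RatFunc F) P.det :=
  ((algebraMap F[X] (RatFunc F)).map_det P).symm

theorem isUnit_matToRat_iff [Fintype ν] [DecidableEq ν] {P : Matrix ν ν F[X]} :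
    IsUnit (matToRat P) ↔ P.det ≠ 0 := by
  rw [isUnit_iff_isUnit_det, isUnit_iff_ne_zero, det_matToRat, Ne,
    map_eq_zero_iff _ (RatFunc.algebraMap_injective F)]

theorem eval_mulVec [Fintype ν] (a : F) (P : Matrix μ ν F[X]) (v : ν → F[X]) :
    (fun i => ((P *ᵥ v) i).eval a) = matEval a P *ᵥ fun j => (v j).eval a :=
  funext fun i => (evalRingHom a).map_mulVec P v i

theorem exists_eq_X_sub_C_smul {a : F} {v : ν → F[X]} (hv : (fun j => (v j).eval a) = 0) :
    ∃ w, v = (X - C a) • w := by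
  choose w hw using fun j => dvd_iff_isRoot.2 (congrFun hv j)
  exact ⟨w, funext hw⟩

theorem matEval_zero_matRev (d : ℕ) (P : Matrix μ ν F[X]) :
    matEval 0 (matRev d P) = P.map fun p => p.coeff d := by
  ext i j
  simp [matEval, matRev, ← coeff_zero_eq_eval_zero, coeff_reflect]

theorem mem_rightNullSpace [Fintype ν] {R : Matrix μ ν (RatFunc F)} {x : ν → RatFunc F} :
    x ∈ rightNullSpace R ↔ R *ᵥ x = 0 :=
  Iff.rfl

end PolynomialVectors

section VecDegree

variable {F : Type*} [Field F] {μ ν κ : Type*} [Fintype ν]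

theorem natDegree_le_vecDegree (v : ν → F[X]) (j : ν) : (v j).natDegree ≤ vecDegree v :=
  Finset.le_sup (f := fun j => (v j).natDegree) (Finset.mem_univ j)

theorem vecDegree_le_iff {v : ν → F[X]} {d : ℕ} :
    vecDegree v ≤ d ↔ ∀ j, (v j).natDegree ≤ d := by
  simp [vecDegree]

theorem vecDegree_zero : vecDegree (0 : ν → F[X]) = 0 := by
  simp [vecDegree]

theorem vecDegree_C (c : ν → F) : vecDegree (fun j => C (c j)) = 0 := by
  simp [vecDegree]

theorem vecDegree_sumElim [Fintype μ] (y : μ → F[X]) (x : ν → F[X]) :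
    vecDegree (Sum.elim y x) = max (vecDegree y) (vecDegree x) :=
  eq_of_forall_ge_iff fun d => by simp only [max_le_iff, vecDegree_le_iff, Sum.forall]; rfl

theorem coeff_vecDegree_ne_zero {v : ν → F[X]} (hv : v ≠ 0) :
    (fun j => (v j).coeff (vecDegree v)) ≠ 0 := by
  obtain ⟨j₀, hj₀⟩ := Function.ne_iff.1 hv
  obtain ⟨j, -, hj⟩ := Finset.exists_mem_eq_sup Finset.univ ⟨j₀, Finset.mem_univ _⟩
    fun j => (v j).natDegree
  change vecDegree v = (v j).natDegree at hj
  intro h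
  have hvj : v j = 0 := by
    rw [← leadingCoeff_eq_zero, leadingCoeff, ← hj]
    exact congrFun h j
  have hdeg : vecDegree v = 0 := by rw [hj, hvj, natDegree_zero]
  have hconst : (v j₀).natDegree = 0 := Nat.le_zero.1 (hdeg ▸ natDegree_le_vecDegree v j₀)
  refine hj₀ (leadingCoeff_eq_zero.1 ?_)
  rw [leadingCoeff, hconst, ← hdeg]
  exact congrFun h j₀

theorem le_vecDegree_of_coeff_ne_zero {v : ν → F[X]} {d : ℕ}
    (h : (fun j => (v j).coeff d) ≠ 0) : d ≤ vecDegree v := by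
  obtain ⟨j, hj⟩ := Function.ne_iff.1 h
  exact (le_natDegree_of_ne_zero hj).trans (natDegree_le_vecDegree v j)

theorem vecDegree_smul {q : F[X]} (hq : q ≠ 0) {v : ν → F[X]} (hv : v ≠ 0) :
    vecDegree (q • v) = q.natDegree + vecDegree v := by
  refine le_antisymm (vecDegree_le_iff.2 fun j => natDegree_mul_le_of_le le_rfl
    (natDegree_le_vecDegree v j)) (le_vecDegree_of_coeff_ne_zero ?_)
  obtain ⟨j, hj⟩ := Function.ne_iff.1 (coeff_vecDegree_ne_zero hv)
  refine Function.ne_iff.2 ⟨j, ?_⟩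
  simp only [Pi.smul_apply, smul_eq_mul,
    coeff_mul_add_eq_of_natDegree_le le_rfl (natDegree_le_vecDegree v j)]
  exact mul_ne_zero (leadingCoeff_ne_zero.2 hq) hj

theorem coeff_mulVec_add {P : Matrix μ ν F[X]} {d e : ℕ} (hP : ∀ i j, (P i j).natDegree ≤ d)
    {v : ν → F[X]} (hv : vecDegree v ≤ e) :
    (fun i => ((P *ᵥ v) i).coeff (d + e)) =
      matEval 0 (matRev d P) *ᵥ fun j => (v j).coeff e := by
  ext i
  simp only [matEval_zero_matRev, mulVec, dotProduct, finsetSum_coeff, map_apply]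
  exact Finset.sum_congr rfl fun j _ =>
    coeff_mul_add_eq_of_natDegree_le (hP i j) ((natDegree_le_vecDegree v j).trans hv)

theorem vecDegree_mulVec_le [Fintype μ] {P : Matrix μ ν F[X]} {d : ℕ}
    (hP : ∀ i j, (P i j).natDegree ≤ d) (v : ν → F[X]) :
    vecDegree (P *ᵥ v) ≤ d + vecDegree v :=
  vecDegree_le_iff.2 fun i => natDegree_sum_le_of_forall_le _ _ fun j _ =>
    natDegree_mul_le_of_le (hP i j) (natDegree_le_vecDegree v j)

theorem natDegree_mul_apply_le {P : Matrix μ ν F[X]} {Q : Matrix ν κ F[X]} {d e : ℕ}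
    (hP : ∀ i j, (P i j).natDegree ≤ d) (hQ : ∀ i j, (Q i j).natDegree ≤ e) (i : μ) (k : κ) :
    ((P * Q) i k).natDegree ≤ d + e :=
  natDegree_sum_le_of_forall_le _ _ fun j _ => natDegree_mul_le_of_le (hP i j) (hQ j k)

theorem natDegree_transpose_le {N : Matrix μ ν F[X]} {ρ : ℕ} (hN : ∀ i, vecDegree (N i) = ρ)
    (j : ν) (i : μ) : (Nᵀ j i).natDegree ≤ ρ :=
  (natDegree_le_vecDegree (N i) j).trans (hN i).le

end VecDegree

section FullColumnRank

variable {F : Type*} [Field F] {μ ν : Type*} [Fintype ν]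

/-- The polynomial matrix `P`, viewed as a matrix of degree `d`, has full column rank at every
point of `F ∪ {∞}`, the value at `∞` being `rev_d P (0)`. Over an algebraically closed field this
makes `P.mulVec` reflect polynomiality of vectors and raise all degrees by exactly `d`. -/
structure HasFullColumnRank (P : Matrix μ ν F[X]) (d : ℕ) : Prop where
  natDegree_le : ∀ i j, (P i j).natDegree ≤ d
  injective_matEval : ∀ a, Injective (matEval a P).mulVec
  injective_matEval_matRev : Injective (matEval 0 (matRev d P)).mulVec

theorem HasFullColumnRank.coeff_mulVec_ne_zero {P : Matrix μ ν F[X]} {d : ℕ}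
    (hP : HasFullColumnRank P d) {v : ν → F[X]} (hv : v ≠ 0) :
    (fun i => ((P *ᵥ v) i).coeff (d + vecDegree v)) ≠ 0 := by
  rw [coeff_mulVec_add hP.natDegree_le le_rfl, ← mulVec_zero (matEval 0 (matRev d P))]
  exact hP.injective_matEval_matRev.ne (coeff_vecDegree_ne_zero hv)

theorem HasFullColumnRank.vecDegree_mulVec [Fintype μ] {P : Matrix μ ν F[X]} {d : ℕ}
    (hP : HasFullColumnRank P d) {v : ν → F[X]} (hv : v ≠ 0) :
    vecDegree (P *ᵥ v) = d + vecDegree v :=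
  le_antisymm (vecDegree_mulVec_le hP.natDegree_le v)
    (le_vecDegree_of_coeff_ne_zero (hP.coeff_mulVec_ne_zero hv))

theorem HasFullColumnRank.mulVec_ne_zero {P : Matrix μ ν F[X]} {d : ℕ}
    (hP : HasFullColumnRank P d) {v : ν → F[X]} (hv : v ≠ 0) : P *ᵥ v ≠ 0 :=
  fun h => hP.coeff_mulVec_ne_zero hv (by simp only [h, Pi.zero_apply, coeff_zero]; rfl)

theorem exists_eq_prod_smul_of_mulVec_eq {P : Matrix μ ν F[X]}
    (hP : ∀ a, Injective (matEval a P).mulVec) (s : Multiset F) {v : ν → F[X]} {g : μ → F[X]}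
    (h : P *ᵥ v = (s.map fun a => X - C a).prod • g) :
    ∃ w, v = (s.map fun a => X - C a).prod • w := by
  induction s using Multiset.induction_on generalizing v with
  | empty => exact ⟨v, by simp⟩
  | cons a s ih =>
    rw [Multiset.map_cons, Multiset.prod_cons] at *
    rw [mul_smul] at h
    have heval : (fun j => (v j).eval a) = 0 := hP a <| by
      rw [← eval_mulVec, h, mulVec_zero]
      ext i
      simp
    obtain ⟨w, rfl⟩ := exists_eq_X_sub_C_smul heval
    rw [mulVec_smul] at h
    obtain ⟨w', rfl⟩ := ih (smul_right_injective _ (X_sub_C_ne_zero a) h)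
    exact ⟨w', smul_smul _ _ _⟩

variable [IsAlgClosed F]

theorem exists_eq_smul_of_mulVec_eq_smul {P : Matrix μ ν F[X]}
    (hP : ∀ a, Injective (matEval a P).mulVec) {q : F[X]} (hq : q ≠ 0) {v : ν → F[X]}
    {g : μ → F[X]} (h : P *ᵥ v = q • g) : ∃ w, v = q • w := by
  have hsplit := (IsAlgClosed.splits q).eq_prod_roots
  rw [hsplit, mul_comm, mul_smul] at h
  obtain ⟨w, hw⟩ := exists_eq_prod_smul_of_mulVec_eq hP q.roots h
  refine ⟨C q.leadingCoeff⁻¹ • w, ?_⟩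
  nth_rw 1 [hsplit]
  rw [hw, smul_smul, mul_right_comm, ← C_mul,
    mul_inv_cancel₀ (leadingCoeff_ne_zero.2 hq), C_1, one_mul]

theorem exists_vecToRat_eq_of_mulVec_eq {P : Matrix μ ν F[X]}
    (hP : ∀ a, Injective (matEval a P).mulVec) {w : ν → RatFunc F} {g : μ → F[X]}
    (h : matToRat P *ᵥ w = vecToRat g) : ∃ v, vecToRat v = w := by
  obtain ⟨⟨q, hq⟩, hint⟩ := IsLocalization.exist_integer_multiples
    (nonZeroDivisors F[X]) Finset.univ w
  choose v hv using fun j => hint j (Finset.mem_univ j)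
  have hq₀ : q ≠ 0 := nonZeroDivisors.ne_zero hq
  have hvw : vecToRat v = algebraMap F[X] (RatFunc F) q • w := by
    ext j
    simpa [vecToRat, Algebra.smul_def] using hv j
  have hPv : P *ᵥ v = q • g := vecToRat_injective <| by
    rw [vecToRat_mulVec, hvw, mulVec_smul, h, vecToRat_smul]
  obtain ⟨u, rfl⟩ := exists_eq_smul_of_mulVec_eq_smul hP hq₀ hPv
  rw [vecToRat_smul] at hvw
  exact ⟨u, smul_right_injective _ (RatFunc.algebraMap_ne_zero hq₀) hvw⟩

theorem HasFullColumnRank.injective_matToRat_mulVec {P : Matrix μ ν F[X]} {d : ℕ}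
    (hP : HasFullColumnRank P d) : Injective (matToRat P).mulVec := by
  refine (injective_iff_map_eq_zero (matToRat P).mulVecLin).2 fun w hw => ?_
  rw [mulVecLin_apply, ← vecToRat_zero] at hw
  obtain ⟨v, rfl⟩ := exists_vecToRat_eq_of_mulVec_eq hP.injective_matEval hw
  rw [← vecToRat_mulVec, vecToRat_injective.eq_iff] at hw
  exact vecToRat_eq_zero.2 (by_contra fun hv => hP.mulVec_ne_zero hv hw)

end FullColumnRank

section MinimalBasis

variable {F : Type*} [Field F] {ι ν : Type*}

theorem IsPolynomialBasis.mem {V : Submodule (RatFunc F) (ν → RatFunc F)} {b : ι → ν → F[X]}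
    (hb : IsPolynomialBasis V b) (i : ι) : vecToRat (b i) ∈ V :=
  hb.2 ▸ Submodule.subset_span (Set.mem_range_self i)

theorem IsPolynomialBasis.ne_zero {V : Submodule (RatFunc F) (ν → RatFunc F)} {b : ι → ν → F[X]}
    (hb : IsPolynomialBasis V b) (i : ι) : b i ≠ 0 :=
  fun h => hb.1.ne_zero i (by rw [h, vecToRat_zero])

variable [Fintype ι]

theorem IsPolynomialBasis.sum_smul_ne_zero {V : Submodule (RatFunc F) (ν → RatFunc F)}
    {b : ι → ν → F[X]} (hb : IsPolynomialBasis V b) {c : ι → F[X]} (hc : c ≠ 0) :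
    ∑ i, c i • b i ≠ 0 := by
  contrapose! hc
  ext1 i
  have hci := Fintype.linearIndependent_iff.1 hb.1 _
    (by rw [← vecToRat_sum_smul, hc, vecToRat_zero]) i
  exact (map_eq_zero_iff _ (RatFunc.algebraMap_injective F)).1 hci

theorem IsPolynomialBasis.exchange [Finite ν] [DecidableEq ι]
    {V : Submodule (RatFunc F) (ν → RatFunc F)} {b : ι → ν → F[X]} (hb : IsPolynomialBasis V b)
    {c : ι → F[X]} {i₀ : ι} (hc : c i₀ ≠ 0) {q : F[X]} (hq : q ≠ 0) {v : ν → F[X]}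
    (h : ∑ i, c i • b i = q • v) : IsPolynomialBasis V (update b i₀ v) := by
  have hq' := RatFunc.algebraMap_ne_zero hq
  have hsum := congrArg vecToRat h
  rw [vecToRat_sum_smul, vecToRat_smul] at hsum
  have hv : vecToRat v ∈ V := by
    rw [← V.smul_mem_iff hq', ← hsum]
    exact V.sum_mem fun i _ => V.smul_mem _ (hb.mem i)
  have hli : LinearIndependent (RatFunc F) fun i => vecToRat (update b i₀ v i) := by
    rw [show (fun i => vecToRat (update b i₀ v i)) = _ from comp_update vecToRat b i₀ v]
    refine hb.1.update i₀ _ ⟨_, mem_nonZeroDivisors_of_ne_zero hq',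
      Finsupp.equivFunOnFinite.symm fun i => algebraMap F[X] (RatFunc F) (c i),
      mem_nonZeroDivisors_of_ne_zero (RatFunc.algebraMap_ne_zero hc), ?_⟩
    rw [← hsum, Finsupp.linearCombination_apply, Finsupp.sum_fintype _ _ (by simp)]
    rfl
  refine ⟨hli, Submodule.eq_of_le_of_finrank_le (Submodule.span_le.2 ?_) ?_⟩
  · rintro _ ⟨i, rfl⟩
    obtain rfl | hi := eq_or_ne i i₀
    · simpa only [update_self, SetLike.mem_coe] using hv
    · simpa only [update_of_ne hi, SetLike.mem_coe] using hb.mem i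
  · rw [finrank_span_eq_card hli, ← hb.2, finrank_span_eq_card hb.1]

variable [Fintype ν]

theorem IsMinimalBasis.vecDegree_le {V : Submodule (RatFunc F) (ν → RatFunc F)}
    {b : ι → ν → F[X]} (hb : IsMinimalBasis V b) {c : ι → F[X]} {i₀ : ι} (hc : c i₀ ≠ 0)
    {q : F[X]} (hq : q ≠ 0) {v : ν → F[X]} (h : ∑ i, c i • b i = q • v) :
    vecDegree (b i₀) ≤ vecDegree v := by
  classical
  have hle := hb.2 _ (hb.1.exchange hc hq h)
  simp only [apply_update fun _ => vecDegree,
    Finset.sum_update_of_mem (Finset.mem_univ i₀)] at hle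
  rw [Finset.sum_eq_add_sum_sdiff_singleton_of_mem (Finset.mem_univ i₀)] at hle
  exact le_of_add_le_add_right hle

end MinimalBasis

section RowMinimalBasis

variable {F : Type*} [Field F] {μ ν : Type*} [Fintype μ] [Fintype ν] {N : Matrix μ ν F[X]} {ρ : ℕ}

theorem IsRowMinimalBasis.transpose_mulVec_ne_zero (hN : IsRowMinimalBasis N) {c : μ → F[X]}
    (hc : c ≠ 0) : Nᵀ *ᵥ c ≠ 0 := by
  simpa only [mulVec_eq_sum, op_smul_eq_smul, transpose_transpose] using hN.1.sum_smul_ne_zero hc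

theorem IsRowMinimalBasis.le_vecDegree (hN : IsRowMinimalBasis N) (hρ : ∀ i, vecDegree (N i) = ρ)
    {c : μ → F[X]} (hc : c ≠ 0) {q : F[X]} (hq : q ≠ 0) {v : ν → F[X]} (h : Nᵀ *ᵥ c = q • v) :
    ρ ≤ vecDegree v := by
  obtain ⟨i₀, hi₀⟩ := Function.ne_iff.1 hc
  simp only [mulVec_eq_sum, op_smul_eq_smul, transpose_transpose] at h
  exact hρ i₀ ▸ hN.vecDegree_le hi₀ hq h

/-- Forney: a rank drop of the constant combinations of the rows, either at a finite point or at
infinity, would allow a row to be exchanged for one of smaller degree. -/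
theorem IsRowMinimalBasis.hasFullColumnRank_transpose (hN : IsRowMinimalBasis N)
    (hρ : ∀ i, vecDegree (N i) = ρ) : HasFullColumnRank Nᵀ ρ := by
  have hconst {c : μ → F} (hc : c ≠ 0) : (fun i => C (c i)) ≠ 0 := by
    simpa [funext_iff] using hc
  have hdeg (c : μ → F) : vecDegree (Nᵀ *ᵥ fun i => C (c i)) ≤ ρ := by
    simpa only [vecDegree_C, add_zero] using
      vecDegree_mulVec_le (natDegree_transpose_le hρ) fun i => C (c i)
  refine ⟨natDegree_transpose_le hρ, fun a => ?_, ?_⟩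
  · refine (injective_iff_map_eq_zero (matEval a Nᵀ).mulVecLin).2 fun c hNc => ?_
    by_contra hc
    obtain ⟨v, hv⟩ := exists_eq_X_sub_C_smul (a := a) (v := Nᵀ *ᵥ fun i => C (c i)) <| by
      simpa only [eval_mulVec, eval_C, mulVecLin_apply] using hNc
    have hv₀ : v ≠ 0 := by
      rintro rfl
      exact hN.transpose_mulVec_ne_zero (hconst hc) (hv.trans (smul_zero _))
    have hle := hN.le_vecDegree hρ (hconst hc) (X_sub_C_ne_zero a) hv
    have hge := hdeg c
    rw [hv, vecDegree_smul (X_sub_C_ne_zero a) hv₀, natDegree_X_sub_C] at hge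
    lia
  · refine (injective_iff_map_eq_zero (matEval 0 (matRev ρ Nᵀ)).mulVecLin).2 fun c hNc => ?_
    by_contra hc
    have hdeg' : vecDegree (Nᵀ *ᵥ fun i => C (c i)) = ρ :=
      (hdeg c).antisymm (hN.le_vecDegree hρ (hconst hc) one_ne_zero (one_smul _ _).symm)
    have hcoeff := coeff_vecDegree_ne_zero (hN.transpose_mulVec_ne_zero (hconst hc))
    rw [hdeg', ← add_zero ρ,
      coeff_mulVec_add (natDegree_transpose_le hρ) (vecDegree_C c).le] at hcoeff
    simp only [coeff_C_zero] at hcoeff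
    exact hcoeff hNc

end RowMinimalBasis

section DegreeShift

variable {F : Type*} [Field F] {ι μ ν : Type*} [Fintype μ] [Fintype ν]

/-- Multiplication by the polynomial matrix `Q` maps the rational subspace `V` bijectively onto
`W`, in such a way that its inverse preserves polynomial vectors and that the degrees of nonzero
polynomial vectors grow by exactly `d`. This is what is needed in order to transport minimal bases
and minimal indices between `V` and `W`. -/
structure IsDegreeShift (Q : Matrix ν μ F[X]) (V : Submodule (RatFunc F) (μ → RatFunc F))
    (W : Submodule (RatFunc F) (ν → RatFunc F)) (d : ℕ) : Prop where
  bijOn : Set.BijOn (matToRat Q).mulVec V W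
  exists_vecToRat_eq : ∀ v ∈ V, ∀ w, matToRat Q *ᵥ v = vecToRat w → ∃ v', vecToRat v' = v
  vecDegree_mulVec : ∀ v ≠ 0, vecToRat v ∈ V → vecDegree (Q *ᵥ v) = d + vecDegree v

variable {Q : Matrix ν μ F[X]} {V : Submodule (RatFunc F) (μ → RatFunc F)}
  {W : Submodule (RatFunc F) (ν → RatFunc F)} {d : ℕ}

theorem HasFullColumnRank.isDegreeShift [IsAlgClosed F] (hQ : HasFullColumnRank Q d)
    (h : (matToRat Q).mulVec '' V = W) : IsDegreeShift Q V W d where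
  bijOn := h ▸ hQ.injective_matToRat_mulVec.injOn.bijOn_image
  exists_vecToRat_eq _ _ _ := exists_vecToRat_eq_of_mulVec_eq hQ.injective_matEval
  vecDegree_mulVec _ hv _ := hQ.vecDegree_mulVec hv

namespace IsDegreeShift

theorem exists_mulVec_eq (h : IsDegreeShift Q V W d) {w : ν → F[X]} (hw : vecToRat w ∈ W) :
    ∃ v, vecToRat v ∈ V ∧ Q *ᵥ v = w := by
  obtain ⟨v, hv, hQv⟩ := h.bijOn.surjOn hw
  obtain ⟨v, rfl⟩ := h.exists_vecToRat_eq v hv w hQv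
  exact ⟨v, hv, vecToRat_injective ((vecToRat_mulVec Q v).trans hQv)⟩

theorem isPolynomialBasis_mulVec_iff (h : IsDegreeShift Q V W d) {b : ι → μ → F[X]}
    (hb : ∀ i, vecToRat (b i) ∈ V) :
    IsPolynomialBasis W (fun i => Q *ᵥ b i) ↔ IsPolynomialBasis V b := by
  have hspan : Submodule.span (RatFunc F) (Set.range fun i => vecToRat (b i)) ≤ V :=
    Submodule.span_le.2 (Set.range_subset_iff.2 hb)
  have hcomp : (fun i => vecToRat (Q *ᵥ b i)) =
      (matToRat Q).mulVecLin ∘ fun i => vecToRat (b i) :=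
    funext fun i => vecToRat_mulVec Q (b i)
  have hW : V.map (matToRat Q).mulVecLin = W := SetLike.coe_injective h.bijOn.image_eq
  rw [IsPolynomialBasis, IsPolynomialBasis, hcomp,
    (matToRat Q).mulVecLin.linearIndependent_iff_of_injOn (h.bijOn.injOn.mono hspan),
    Set.range_comp, ← Submodule.map_span, ← hW]
  exact and_congr_right fun _ => SetLike.coe_set_eq.symm.trans <|
    (h.bijOn.injOn.image_eq_image_iff hspan subset_rfl).trans SetLike.coe_set_eq

theorem exists_isPolynomialBasis (h : IsDegreeShift Q V W d) {c : ι → ν → F[X]}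
    (hc : IsPolynomialBasis W c) :
    ∃ b : ι → μ → F[X], IsPolynomialBasis V b ∧ (fun i => Q *ᵥ b i) = c := by
  choose b hb hbc using fun i => h.exists_mulVec_eq (hc.mem i)
  obtain rfl : (fun i => Q *ᵥ b i) = c := funext hbc
  exact ⟨b, (h.isPolynomialBasis_mulVec_iff hb).1 hc, rfl⟩

variable [Fintype ι]

theorem sum_vecDegree_mulVec (h : IsDegreeShift Q V W d) {b : ι → μ → F[X]}
    (hb : IsPolynomialBasis V b) :
    ∑ i, vecDegree (Q *ᵥ b i) = Fintype.card ι * d + ∑ i, vecDegree (b i) := by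
  simp only [h.vecDegree_mulVec _ (hb.ne_zero _) (hb.mem _), Finset.sum_add_distrib,
    Finset.sum_const, Finset.card_univ, smul_eq_mul]

theorem isMinimalBasis_mulVec_iff (h : IsDegreeShift Q V W d) {b : ι → μ → F[X]}
    (hb : IsPolynomialBasis V b) :
    IsMinimalBasis W (fun i => Q *ᵥ b i) ↔ IsMinimalBasis V b := by
  refine and_congr (h.isPolynomialBasis_mulVec_iff hb.mem) ⟨fun hmin b' hb' => ?_,
    fun hmin c hc => ?_⟩
  · have hle := hmin _ ((h.isPolynomialBasis_mulVec_iff hb'.mem).2 hb')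
    rwa [h.sum_vecDegree_mulVec hb, h.sum_vecDegree_mulVec hb', add_le_add_iff_left] at hle
  · obtain ⟨b', hb', rfl⟩ := h.exists_isPolynomialBasis hc
    rw [h.sum_vecDegree_mulVec hb, h.sum_vecDegree_mulVec hb', add_le_add_iff_left]
    exact hmin b' hb'

theorem isMinimalBasis_mulVec (h : IsDegreeShift Q V W d) {b : ι → μ → F[X]}
    (hb : IsMinimalBasis V b) : IsMinimalBasis W fun i => Q *ᵥ b i :=
  (h.isMinimalBasis_mulVec_iff hb.1).2 hb

theorem exists_isMinimalBasis (h : IsDegreeShift Q V W d) {c : ι → ν → F[X]}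
    (hc : IsMinimalBasis W c) :
    ∃ b : ι → μ → F[X], IsMinimalBasis V b ∧ ∀ i, c i = Q *ᵥ b i := by
  obtain ⟨b, hb, rfl⟩ := h.exists_isPolynomialBasis hc.1
  exact ⟨b, (h.isMinimalBasis_mulVec_iff hb).1 hc, fun _ => rfl⟩

variable {s : ℕ} {ε : Fin s → ℕ}

theorem areMinimalIndices_add (h : IsDegreeShift Q V W d) (hε : AreMinimalIndices V ε) :
    AreMinimalIndices W fun i => d + ε i := by
  obtain ⟨hmono, b, hb, hbε⟩ := hε
  refine ⟨hmono.const_add d, _, h.isMinimalBasis_mulVec hb, fun i => ?_⟩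
  rw [h.vecDegree_mulVec _ (hb.1.ne_zero i) (hb.1.mem i), hbε]

theorem areMinimalIndices_sub (h : IsDegreeShift Q V W d) (hε : AreMinimalIndices W ε) :
    (∀ i, d ≤ ε i) ∧ AreMinimalIndices V fun i => ε i - d := by
  obtain ⟨hmono, c, hc, hcε⟩ := hε
  obtain ⟨b, hb, hbc⟩ := h.exists_isMinimalBasis hc
  have hε (i : Fin s) : ε i = d + vecDegree (b i) := by
    rw [← hcε, hbc, h.vecDegree_mulVec _ (hb.1.ne_zero i) (hb.1.mem i)]
  refine ⟨fun i => hε i ▸ Nat.le_add_right _ _,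
    fun i j hij => Nat.sub_le_sub_right (hmono hij) d, b, hb, fun i => ?_⟩
  simp only [hε, Nat.add_sub_cancel_left]

end IsDegreeShift

end DegreeShift

section DualMinimalBases

variable {F : Type*} [Field F] {ι κ μ ν : Type*} [Fintype κ] [Fintype μ] [Fintype ν]
  {K : Matrix κ ν F[X]} {N : Matrix μ ν F[X]}

theorem AreDualMinimalBases.rightNullSpace_eq_range (h : AreDualMinimalBases K N) :
    rightNullSpace (matToRat K) = LinearMap.range (matToRat Nᵀ).mulVecLin := by
  have hK : (matToRat K).rank = Fintype.card κ := LinearIndependent.rank_matrix h.left_minimal.1.1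
  have hN : (matToRat Nᵀ).rank = Fintype.card μ :=
    (rank_transpose (matToRat N)).trans (LinearIndependent.rank_matrix h.right_minimal.1.1)
  refine (Submodule.eq_of_le_of_finrank_le ?_ ?_).symm
  · rintro _ ⟨w, rfl⟩
    rw [mem_rightNullSpace, mulVecLin_apply, mulVec_mulVec, ← matToRat_mul, h.mul_transpose,
      matToRat_zero, zero_mulVec]
  · have hrank := LinearMap.finrank_range_add_finrank_ker (matToRat K).mulVecLin
    rw [Module.finrank_fintype_fun_eq_card, ← h.card_add] at hrank
    exact (add_left_cancel ((congrArg (· + _) hK.symm).trans hrank)).trans hN.symm |>.le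

theorem AreDualMinimalBases.mulVec_eq_zero_iff (h : AreDualMinimalBases K N)
    {x : ν → RatFunc F} : matToRat K *ᵥ x = 0 ↔ ∃ w, matToRat Nᵀ *ᵥ w = x := by
  rw [← mem_rightNullSpace, h.rightNullSpace_eq_range]
  rfl

theorem AreDualMinimalBases.exists_vecToRat_eq [IsAlgClosed F] [Fintype ι]
    (h : AreDualMinimalBases K N) {ρ d e : ℕ} (hρ : ∀ i, vecDegree (N i) = ρ)
    {M : Matrix ι ν F[X]} (hM : HasFullColumnRank (M * Nᵀ) (d + ρ)) {y : ν → RatFunc F}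
    (hKy : matToRat K *ᵥ y = 0) {g : ι → F[X]} (hMy : matToRat M *ᵥ y = vecToRat g)
    (hg : vecDegree g ≤ d + e) : ∃ y', vecToRat y' = y ∧ vecDegree y' ≤ e := by
  obtain ⟨w, rfl⟩ := h.mulVec_eq_zero_iff.1 hKy
  rw [mulVec_mulVec, ← matToRat_mul] at hMy
  obtain ⟨w, rfl⟩ := exists_vecToRat_eq_of_mulVec_eq hM.injective_matEval hMy
  refine ⟨Nᵀ *ᵥ w, vecToRat_mulVec Nᵀ w, ?_⟩
  obtain rfl | hw := eq_or_ne w 0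
  · rw [mulVec_zero, vecDegree_zero]
    exact Nat.zero_le e
  · have hdeg := vecDegree_mulVec_le (natDegree_transpose_le hρ) w
    rw [← vecToRat_mulVec, vecToRat_injective.eq_iff] at hMy
    rw [← hMy, hM.vecDegree_mulVec hw] at hg
    lia

theorem AreDualMinimalBases.det_fromRows_ne_zero [DecidableEq κ] [DecidableEq μ]
    {K : Matrix κ (μ ⊕ κ) F[X]} {N : Matrix μ (μ ⊕ κ) F[X]} (h : AreDualMinimalBases K N)
    {M : Matrix μ (μ ⊕ κ) F[X]} (hM : (M * Nᵀ).det ≠ 0) : (fromRows M K).det ≠ 0 := by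
  rw [← isUnit_matToRat_iff, ← mulVec_injective_iff_isUnit]
  refine (injective_iff_map_eq_zero (matToRat (fromRows M K)).mulVecLin).2 fun y hy => ?_
  rw [mulVecLin_apply, matToRat_fromRows, fromRows_mulVec, ← Sum.elim_zero_zero,
    Sum.elim_eq_iff, h.mulVec_eq_zero_iff] at hy
  obtain ⟨hMy, w, rfl⟩ := hy
  rw [mulVec_mulVec, ← matToRat_mul] at hMy
  rw [← isUnit_matToRat_iff, ← mulVec_injective_iff_isUnit] at hM
  rw [hM (hMy.trans (mulVec_zero _).symm), mulVec_zero]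

end DualMinimalBases

section SchurComplement

variable {F : Type*} [Field F] {α β γ : Type*}

theorem fromCols_zero_one_mulVec {R : Type*} [Semiring R] [Fintype α] [Fintype γ] [DecidableEq γ]
    (v : α ⊕ γ → R) : (fromCols 0 1 : Matrix γ (α ⊕ γ) R) *ᵥ v = v ∘ Sum.inr := by
  rw [fromCols_mulVec, zero_mulVec, zero_add, one_mulVec]

theorem matToRat_fromCols_zero_one [DecidableEq γ] :
    matToRat (fromCols 0 1 : Matrix γ (α ⊕ γ) F[X]) = fromCols 0 1 := by
  rw [matToRat, fromCols_map, Matrix.map_zero _ (map_zero _),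
    Matrix.map_one _ (map_zero _) (map_one _)]

variable [Fintype α] [DecidableEq α]

theorem transferFunction_fromBlocks_neg (A : Matrix α α F[X]) (B : Matrix α γ F[X])
    (C : Matrix β α F[X]) (D : Matrix β γ F[X]) :
    transferFunction (fromBlocks A B (-C) D) =
      matToRat D + matToRat C * (matToRat A)⁻¹ * matToRat B := by
  simp only [transferFunction, toBlocks_fromBlocks₁₁, toBlocks_fromBlocks₁₂, toBlocks_fromBlocks₂₁,
    toBlocks_fromBlocks₂₂, matToRat_neg, Matrix.neg_mul, sub_neg_eq_add]

variable [Fintype γ]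

theorem fromBlocks_mulVec_sumElim_eq_zero_iff {R : Type*} [CommRing R] {A : Matrix α α R}
    (hA : IsUnit A) (B : Matrix α γ R) (C : Matrix β α R) (D : Matrix β γ R) (y : α → R)
    (x : γ → R) : fromBlocks A B C D *ᵥ Sum.elim y x = 0 ↔
      y = -(A⁻¹ *ᵥ (B *ᵥ x)) ∧ (D - C * A⁻¹ * B) *ᵥ x = 0 := by
  have hdet := (isUnit_iff_isUnit_det A).1 hA
  have hy : A *ᵥ y + B *ᵥ x = 0 ↔ y = -(A⁻¹ *ᵥ (B *ᵥ x)) := by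
    rw [← (mulVec_injective_of_isUnit hA).eq_iff (a := y), mulVec_neg, mulVec_mulVec _ A,
      mul_nonsing_inv A hdet, one_mulVec, eq_neg_iff_add_eq_zero]
  rw [fromBlocks_mulVec, ← Sum.elim_zero_zero, Sum.elim_eq_iff]
  simp only [Sum.elim_comp_inl, Sum.elim_comp_inr, hy]
  refine and_congr_right fun h => ?_
  rw [h, sub_mulVec, mulVec_neg, neg_add_eq_sub]
  simp only [mulVec_mulVec, Matrix.mul_assoc]

theorem matToRat_mulVec_sumElim_eq_zero_iff {P : Matrix (α ⊕ β) (α ⊕ γ) F[X]}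
    (hP : P.toBlocks₁₁.det ≠ 0) {y : α → RatFunc F} {x : γ → RatFunc F} :
    matToRat P *ᵥ Sum.elim y x = 0 ↔
      y = -((matToRat P.toBlocks₁₁)⁻¹ *ᵥ (matToRat P.toBlocks₁₂ *ᵥ x)) ∧
        x ∈ rightNullSpace (transferFunction P) := by
  conv_lhs => rw [← fromBlocks_toBlocks P, matToRat_fromBlocks]
  exact fromBlocks_mulVec_sumElim_eq_zero_iff (isUnit_matToRat_iff.2 hP) _ _ _ _ _

theorem mem_rightNullSpace_transferFunction {P : Matrix (α ⊕ β) (α ⊕ γ) F[X]}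
    (hP : P.toBlocks₁₁.det ≠ 0) {x : γ → RatFunc F} :
    x ∈ rightNullSpace (transferFunction P) ↔ ∃ y, matToRat P *ᵥ Sum.elim y x = 0 := by
  simp only [matToRat_mulVec_sumElim_eq_zero_iff hP, exists_eq_left]

theorem bijOn_rightNullSpace_transferFunction [DecidableEq γ] {P : Matrix (α ⊕ β) (α ⊕ γ) F[X]}
    (hP : P.toBlocks₁₁.det ≠ 0) :
    Set.BijOn (matToRat (fromCols 0 1 : Matrix γ (α ⊕ γ) F[X])).mulVec
      (rightNullSpace (matToRat P)) (rightNullSpace (transferFunction P)) := by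
  have hker {v : α ⊕ γ → RatFunc F} (hv : v ∈ rightNullSpace (matToRat P)) :=
    (matToRat_mulVec_sumElim_eq_zero_iff hP).1 ((Sum.elim_comp_inl_inr v).symm ▸ hv)
  simp only [Set.BijOn, Set.MapsTo, Set.InjOn, matToRat_fromCols_zero_one,
    fromCols_zero_one_mulVec]
  refine ⟨fun v hv => (hker hv).2, fun v hv v' hv' h => ?_, fun x hx => ?_⟩
  · rw [← Sum.elim_comp_inl_inr v, ← Sum.elim_comp_inl_inr v', (hker hv).1, (hker hv').1, h]
  · obtain ⟨y, hy⟩ := (mem_rightNullSpace_transferFunction hP).1 hx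
    exact ⟨Sum.elim y x, hy, fromCols_zero_one_mulVec _⟩

end SchurComplement

section Linearization

variable {F : Type*} [Field F] {α κ β γ δ ν ω : Type*} [Fintype ν] [Fintype ω]
  {MA : Matrix α ν F[X]} {KA : Matrix κ ν F[X]} {NA : Matrix α ν F[X]} {MB : Matrix α ω F[X]}
  {MC : Matrix β ν F[X]} {MD : Matrix β ω F[X]} {KD : Matrix δ ω F[X]} {ND : Matrix γ ω F[X]}

theorem linearization_mulVec_sumElim_eq_zero_iff {y : ν → RatFunc F} {x : ω → RatFunc F} :
    matToRat (linearization MA KA MB MC MD KD) *ᵥ Sum.elim y x = 0 ↔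
      (matToRat MA *ᵥ y + matToRat MB *ᵥ x = 0 ∧ matToRat KA *ᵥ y = 0) ∧
        -(matToRat MC *ᵥ y) + matToRat MD *ᵥ x = 0 ∧ matToRat KD *ᵥ x = 0 := by
  simp only [linearization, matToRat_fromBlocks, fromBlocks_mulVec, Sum.elim_comp_inl,
    Sum.elim_comp_inr, matToRat_fromRows, fromRows_mulVec, matToRat_zero, matToRat_neg,
    neg_mulVec, zero_mulVec, ← Sum.elim_add_add, ← Sum.elim_zero_zero, Sum.elim_eq_iff,
    add_zero, zero_add]

variable [Fintype α] [Fintype κ]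

theorem linearization_mulVec_sumElim_eq_zero_iff_exists [Fintype γ] [Fintype δ]
    (hA : AreDualMinimalBases KA NA) (hD : AreDualMinimalBases KD ND)
    {y : ν → RatFunc F} {x : ω → RatFunc F} :
    matToRat (linearization MA KA MB MC MD KD) *ᵥ Sum.elim y x = 0 ↔
      ∃ w u, matToRat NAᵀ *ᵥ w = y ∧ matToRat NDᵀ *ᵥ u = x ∧
        matToRat (fromBlocks (MA * NAᵀ) (MB * NDᵀ) (-(MC * NAᵀ)) (MD * NDᵀ)) *ᵥ
          Sum.elim w u = 0 := by
  have hblocks {w : α → RatFunc F} {u : γ → RatFunc F} :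
      matToRat (fromBlocks (MA * NAᵀ) (MB * NDᵀ) (-(MC * NAᵀ)) (MD * NDᵀ)) *ᵥ Sum.elim w u = 0 ↔
        matToRat MA *ᵥ (matToRat NAᵀ *ᵥ w) + matToRat MB *ᵥ (matToRat NDᵀ *ᵥ u) = 0 ∧
          -(matToRat MC *ᵥ (matToRat NAᵀ *ᵥ w)) + matToRat MD *ᵥ (matToRat NDᵀ *ᵥ u) = 0 := by
    simp only [matToRat_fromBlocks, fromBlocks_mulVec, Sum.elim_comp_inl, Sum.elim_comp_inr,
      matToRat_neg, matToRat_mul, neg_mulVec, mulVec_mulVec, ← Sum.elim_zero_zero,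
      Sum.elim_eq_iff]
  simp only [linearization_mulVec_sumElim_eq_zero_iff, hA.mulVec_eq_zero_iff,
    hD.mulVec_eq_zero_iff, hblocks]
  constructor
  · rintro ⟨⟨htop, w, rfl⟩, hbottom, u, rfl⟩
    exact ⟨w, u, rfl, rfl, htop, hbottom⟩
  · rintro ⟨w, u, rfl, rfl, htop, hbottom⟩
    exact ⟨⟨htop, w, rfl⟩, hbottom, u, rfl⟩

theorem exists_vecToRat_eq_of_linearization_mulVec [IsAlgClosed F] [Finite β] {ρ : ℕ}
    (hA : AreDualMinimalBases KA NA) (hρ : ∀ i, vecDegree (NA i) = ρ) (hMB : IsLinearMatrix MB)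
    (hMD : IsLinearMatrix MD) (hAC : HasFullColumnRank (fromRows MA MC * NAᵀ) (1 + ρ))
    {y : ν → RatFunc F} {x : ω → F[X]}
    (h : matToRat (linearization MA KA MB MC MD KD) *ᵥ Sum.elim y (vecToRat x) = 0) :
    ∃ y', vecToRat y' = y ∧ vecDegree y' ≤ vecDegree x := by
  cases nonempty_fintype β
  obtain ⟨⟨htop, hKA⟩, hbottom, -⟩ := linearization_mulVec_sumElim_eq_zero_iff.1 h
  have hE : ∀ i j, (fromRows (-MB) MD i j).natDegree ≤ 1 := by
    rintro (i | i) j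
    · simpa using hMB i j
    · simpa using hMD i j
  refine hA.exists_vecToRat_eq hρ hAC hKA (g := fromRows (-MB) MD *ᵥ x) ?_
    (vecDegree_mulVec_le hE x)
  rw [vecToRat_mulVec, matToRat_fromRows, matToRat_fromRows, fromRows_mulVec, fromRows_mulVec,
    matToRat_neg, neg_mulVec, eq_neg_of_add_eq_zero_left htop, neg_add_eq_zero.1 hbottom]

end Linearization

section LinearizationDegreeShift

variable {F : Type*} [Field F] [IsAlgClosed F] {α κ β γ δ ω : Type*} [Fintype α] [DecidableEq α]
  [Fintype κ] [DecidableEq κ] [Fintype ω] {MA : Matrix α (α ⊕ κ) F[X]}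
  {KA : Matrix κ (α ⊕ κ) F[X]} {NA : Matrix α (α ⊕ κ) F[X]} {MB : Matrix α ω F[X]}
  {MC : Matrix β (α ⊕ κ) F[X]} {MD : Matrix β ω F[X]} {KD : Matrix δ ω F[X]}
  {ND : Matrix γ ω F[X]} {ρ : ℕ}

theorem isDegreeShift_linearization_transferFunction [Finite β] [DecidableEq ω]
    (hA : AreDualMinimalBases KA NA) (hdet : (MA * NAᵀ).det ≠ 0)
    (hρ : ∀ i, vecDegree (NA i) = ρ) (hMB : IsLinearMatrix MB) (hMD : IsLinearMatrix MD)
    (hAC : HasFullColumnRank (fromRows MA MC * NAᵀ) (1 + ρ)) :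
    IsDegreeShift (fromCols 0 1) (rightNullSpace (matToRat (linearization MA KA MB MC MD KD)))
      (rightNullSpace (transferFunction (linearization MA KA MB MC MD KD))) 0 where
  bijOn := bijOn_rightNullSpace_transferFunction (hA.det_fromRows_ne_zero hdet)
  exists_vecToRat_eq v hv x hx := by
    rw [matToRat_fromCols_zero_one, fromCols_zero_one_mulVec] at hx
    rw [mem_rightNullSpace, ← Sum.elim_comp_inl_inr v, hx] at hv
    obtain ⟨y, hy, -⟩ := exists_vecToRat_eq_of_linearization_mulVec hA hρ hMB hMD hAC hv
    exact ⟨Sum.elim y x, by rw [vecToRat_sumElim, hy, ← hx, Sum.elim_comp_inl_inr]⟩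
  vecDegree_mulVec v _ hv := by
    rw [← Sum.elim_comp_inl_inr v, mem_rightNullSpace, vecToRat_sumElim] at hv
    obtain ⟨y, hy, hdeg⟩ := exists_vecToRat_eq_of_linearization_mulVec hA hρ hMB hMD hAC hv
    obtain rfl : y = v ∘ Sum.inl := vecToRat_injective hy
    conv_rhs => rw [← Sum.elim_comp_inl_inr v]
    rw [fromCols_zero_one_mulVec, vecDegree_sumElim, max_eq_right hdeg, zero_add]

theorem isDegreeShift_transpose_transferFunction [Fintype γ] [Fintype δ]
    (hA : AreDualMinimalBases KA NA) (hD : AreDualMinimalBases KD ND)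
    (hdet : (MA * NAᵀ).det ≠ 0) (hρ : ∀ i, vecDegree (ND i) = ρ) :
    IsDegreeShift NDᵀ
      (rightNullSpace (transferFunction
        (fromBlocks (MA * NAᵀ) (MB * NDᵀ) (-(MC * NAᵀ)) (MD * NDᵀ))))
      (rightNullSpace (transferFunction (linearization MA KA MB MC MD KD))) ρ := by
  refine (hD.right_minimal.hasFullColumnRank_transpose hρ).isDegreeShift ?_
  have hL : (linearization MA KA MB MC MD KD).toBlocks₁₁.det ≠ 0 := hA.det_fromRows_ne_zero hdet
  have hS : (fromBlocks (MA * NAᵀ) (MB * NDᵀ) (-(MC * NAᵀ)) (MD * NDᵀ)).toBlocks₁₁.det ≠ 0 := hdet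
  ext x
  simp only [Set.mem_image, SetLike.mem_coe, mem_rightNullSpace_transferFunction hL,
    mem_rightNullSpace_transferFunction hS,
    linearization_mulVec_sumElim_eq_zero_iff_exists hA hD]
  constructor
  · rintro ⟨u, ⟨w, h⟩, rfl⟩
    exact ⟨_, w, u, rfl, rfl, h⟩
  · rintro ⟨_, w, u, rfl, rfl, h⟩
    exact ⟨u, ⟨w, h⟩, rfl⟩

end LinearizationDegreeShift

section RankConditions

variable {F : Type*} [Field F] {α β ν : Type*} [Fintype ν]

theorem mulVec_injective_of_rank_eq_card [Finite α] {P : Matrix α ν F}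
    (hP : P.rank = Fintype.card ν) : Injective P.mulVec := by
  have hrank := LinearMap.finrank_range_add_finrank_ker P.mulVecLin
  rw [Module.finrank_fintype_fun_eq_card, ← hP] at hrank
  exact LinearMap.ker_eq_bot.1 (Submodule.finrank_eq_zero.1 (Nat.add_eq_left.1 hrank))

theorem hasFullColumnRank_fromRows [Finite α] [Finite β] {A : Matrix α ν F[X]}
    {C : Matrix β ν F[X]} {d : ℕ} (hA : ∀ i j, (A i j).natDegree ≤ d)
    (hC : ∀ i j, (C i j).natDegree ≤ d)
    (hfinite : ∀ a, (fromRows (matEval a A) (matEval a C)).rank = Fintype.card ν)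
    (hinfinite : (fromRows (matEval 0 (matRev d A)) (matEval 0 (matRev d C))).rank =
      Fintype.card ν) : HasFullColumnRank (fromRows A C) d where
  natDegree_le := Sum.forall.2 ⟨hA, hC⟩
  injective_matEval a := by
    rw [matEval, fromRows_map]
    exact mulVec_injective_of_rank_eq_card (hfinite a)
  injective_matEval_matRev := by
    rw [matEval, matRev, fromRows_map, fromRows_map]
    exact mulVec_injective_of_rank_eq_card hinfinite

end RankConditions

end RationalLinearization

theorem mainTheorem3_general {F : Type*} [Field F] [IsAlgClosed F] {α β γ δ κ ω : Type*}
    [Fintype α] [DecidableEq α] [Finite β] [Fintype γ] [Fintype δ] [Fintype κ] [DecidableEq κ]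
    [Fintype ω] {ρA ρD : ℕ} {A : Matrix α α F[X]} {B : Matrix α γ F[X]} {C : Matrix β α F[X]}
    {D : Matrix β γ F[X]} (hdet : A.det ≠ 0) {MA : Matrix α (α ⊕ κ) F[X]}
    {KA : Matrix κ (α ⊕ κ) F[X]} {NA : Matrix α (α ⊕ κ) F[X]} {MB : Matrix α ω F[X]}
    {MC : Matrix β (α ⊕ κ) F[X]} {MD : Matrix β ω F[X]} {KD : Matrix δ ω F[X]}
    {ND : Matrix γ ω F[X]} (hdualA : AreDualMinimalBases KA NA)
    (hdualD : AreDualMinimalBases KD ND) (hρA : ∀ i, vecDegree (NA i) = ρA)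
    (hρD : ∀ i, vecDegree (ND i) = ρD) (hMA : IsLinearMatrix MA) (hMB : IsLinearMatrix MB)
    (hMC : IsLinearMatrix MC) (hMD : IsLinearMatrix MD) (hA : MA * NA.transpose = A)
    (hB : MB * ND.transpose = B) (hC : MC * NA.transpose = C) (hD : MD * ND.transpose = D)
    (hfinite : ∀ a, (Matrix.fromRows (matEval a A) (matEval a C)).rank = Fintype.card α)
    (hinfinite : (Matrix.fromRows (matEval 0 (matRev (ρA + 1) A))
      (matEval 0 (matRev (ρA + 1) C))).rank = Fintype.card α) :
    (∀ (s : ℕ) (y : Fin s → α ⊕ κ → F[X]) (x : Fin s → ω → F[X]),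
      IsRightMinimalBasis (matToRat (linearization MA KA MB MC MD KD))
          (fun i => Sum.elim (y i) (x i)) →
        IsRightMinimalBasis (transferFunction (linearization MA KA MB MC MD KD)) x ∧
          ∃ u : Fin s → γ → F[X],
            IsRightMinimalBasis (matToRat D + matToRat C * (matToRat A)⁻¹ * matToRat B) u ∧
              ∀ i, x i = ND.transpose.mulVec (u i)) ∧
    (∀ (s : ℕ) (ε : Fin s → ℕ),
      AreRightMinimalIndices (matToRat (linearization MA KA MB MC MD KD)) ε →
        AreRightMinimalIndices (transferFunction (linearization MA KA MB MC MD KD)) ε ∧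
          (∀ i, ρD ≤ ε i) ∧
            AreRightMinimalIndices (matToRat D + matToRat C * (matToRat A)⁻¹ * matToRat B)
              (fun i => ε i - ρD)) := by
  classical
  subst hA hB hC hD
  have hNA := natDegree_transpose_le hρA
  rw [add_comm ρA] at hinfinite
  have hAC := hasFullColumnRank_fromRows (natDegree_mul_apply_le hMA hNA)
    (natDegree_mul_apply_le hMC hNA) hfinite hinfinite
  rw [← Matrix.fromRows_mul] at hAC
  have hproj := isDegreeShift_linearization_transferFunction (KD := KD) hdualA hdet hρA hMB hMD hAC
  have hdual := isDegreeShift_transpose_transferFunction (MB := MB) (MC := MC) (MD := MD)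
    hdualA hdualD hdet hρD
  rw [transferFunction_fromBlocks_neg] at hdual
  refine ⟨fun s y x hb => ?_, fun s ε hε => ?_⟩
  · have hx := hproj.isMinimalBasis_mulVec hb
    simp only [fromCols_zero_one_mulVec, Sum.elim_comp_inr] at hx
    exact ⟨hx, hdual.exists_isMinimalBasis hx⟩
  · have hεRhat := hproj.areMinimalIndices_add hε
    simp only [zero_add] at hεRhat
    exact ⟨hεRhat, hdual.areMinimalIndices_sub hεRhat⟩

theorem mainTheorem3 {F : Type*} [Field F] [IsAlgClosed F] (n m p ρA ρD : ℕ)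
    (R : Matrix (Fin p) (Fin m) (RatFunc F))
    (A : Matrix (Fin n) (Fin n) F[X]) (B : Matrix (Fin n) (Fin m) F[X])
    (C : Matrix (Fin p) (Fin n) F[X]) (D : Matrix (Fin p) (Fin m) F[X])
    (hA : A.det ≠ 0)
    (hR : R = matToRat D + matToRat C * (matToRat A)⁻¹ * matToRat B)
    -- the `(ρA + 1) n` columns of `L_A` are indexed by `Fin n ⊕ Fin (ρA * n)`,
    -- and the `(ρD + 1) m` columns of `L_D` by `Fin m ⊕ Fin (ρD * m)`
    (MA : Matrix (Fin n) (Fin n ⊕ Fin (ρA * n)) F[X])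
    (KA : Matrix (Fin (ρA * n)) (Fin n ⊕ Fin (ρA * n)) F[X])
    (NA : Matrix (Fin n) (Fin n ⊕ Fin (ρA * n)) F[X])
    (MD : Matrix (Fin p) (Fin m ⊕ Fin (ρD * m)) F[X])
    (KD : Matrix (Fin (ρD * m)) (Fin m ⊕ Fin (ρD * m)) F[X])
    (ND : Matrix (Fin m) (Fin m ⊕ Fin (ρD * m)) F[X])
    (hLA : IsStrongBlockMinimalBasisPencil MA KA NA ρA A)
    (hLD : IsStrongBlockMinimalBasisPencil MD KD ND ρD D)
    (MB : Matrix (Fin n) (Fin m ⊕ Fin (ρD * m)) F[X])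
    (MC : Matrix (Fin p) (Fin n ⊕ Fin (ρA * n)) F[X])
    (hMB : IsLinearMatrix MB) (hMC : IsLinearMatrix MC)
    (hC : MC * NA.transpose = C) (hB : MB * ND.transpose = B)
    (L : Matrix ((Fin n ⊕ Fin (ρA * n)) ⊕ (Fin p ⊕ Fin (ρD * m)))
      ((Fin n ⊕ Fin (ρA * n)) ⊕ (Fin m ⊕ Fin (ρD * m))) F[X])
    (hL : L = linearization MA KA MB MC MD KD)
    (Rhat : Matrix (Fin p ⊕ Fin (ρD * m)) (Fin m ⊕ Fin (ρD * m)) (RatFunc F))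
    (hRhat : Rhat = transferFunction L)
    (hfinite : ∀ a : F, (Matrix.fromRows (matEval a A) (matEval a C)).rank = n)
    (hinfinite : (Matrix.fromRows (matEval 0 (matRev (ρA + 1) A))
      (matEval 0 (matRev (ρA + 1) C))).rank = n) :
    (∀ (s : ℕ) (y : Fin s → (Fin n ⊕ Fin (ρA * n)) → F[X])
        (x : Fin s → (Fin m ⊕ Fin (ρD * m)) → F[X]),
      IsRightMinimalBasis (matToRat L) (fun i => Sum.elim (y i) (x i)) →
        IsRightMinimalBasis Rhat x ∧
          ∃ u : Fin s → Fin m → F[X],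
            IsRightMinimalBasis R u ∧ ∀ i, x i = ND.transpose.mulVec (u i)) ∧
    (∀ (s : ℕ) (ε : Fin s → ℕ), AreRightMinimalIndices (matToRat L) ε →
      AreRightMinimalIndices Rhat ε ∧
        (∀ i, ρD ≤ ε i) ∧ AreRightMinimalIndices R (fun i => ε i - ρD)) := by
  subst hR hL hRhat
  exact mainTheorem3_general hA hLA.dual hLD.dual hLA.rowDegree_dual hLD.rowDegree_dual
    hLA.linear_top hMB hMC hLD.linear_top hLA.associated hB hC hLD.associated
    (by simpa only [Fintype.card_fin]) (by simpa only [Fintype.card_fin])
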